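/- Let $\mathbb{N}_0$ denote the set of non-negative integers. A numerical semigroup is a subset $\Lambda\subseteq\mathbb{N}_0$ that contains $0$, is closed under addition and has finite complement. Its genus is $g=\#(\mathbb{N}_0\setminus\Lambda)$; its conductor is the unique integer $c$ with $c-1\notin\Lambda$ and $c+\mathbb{N}_0\subseteq\Lambda$; and $e$ denotes the number of its minimal generators, i.e. the number of elements of its unique minimal generating set, which consists of the nonzero elements of $\Lambda$ that are not a sum of two nonzero elements of $\Lambda$. Every numerical semigroup $\Lambda$ of genus $g\le 50$ satisfies Wilf's inequality: if $1\le g\le 50$, then $c>g$ and $$e\ \ge\ \frac{c}{c-g}.$$ For $g=0$, that is $\Lambda=\mathbb{N}_0$, where $c=0$ and the quotient reads $0/0$, the inequality holds in the form $c\le e\,(c-g)$. This form holds for all $g\le 50$. -/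

import Mathlib

/-- A numerical semigroup: a subset of `ℕ` that contains `0`, is closed under addition and has
finite complement. -/
structure NumericalSemigroup extends AddSubmonoid ℕ where
  finite_compl : ((carrier : Set ℕ)ᶜ).Finite

namespace NumericalSemigroup

/-- The set of elements of a numerical semigroup. -/
def elements (S : NumericalSemigroup) : Set ℕ := S.carrier

/-- The genus: the number of gaps (a finite number, by `finite_compl`). -/
noncomputable def genus (S : NumericalSemigroup) : ℕ := (S.elementsᶜ).ncard

/-- The conductor: the least `c` with `c + ℕ ⊆ S`. -/
noncomputable def conductor (S : NumericalSemigroup) : ℕ :=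
  sInf {c : ℕ | ∀ n : ℕ, c ≤ n → n ∈ S.elements}

/-- The minimal generators: the nonzero elements of `S` that are not the sum of two nonzero
elements of `S`. By `minimalGenerators_isLeast` they form the least generating set of `S`. -/
def minimalGenerators (S : NumericalSemigroup) : Set ℕ :=
  {a : ℕ | a ∈ S.elements ∧ a ≠ 0 ∧
    ∀ x ∈ S.elements, ∀ y ∈ S.elements, x ≠ 0 → y ≠ 0 → x + y ≠ a}

/-- The number of minimal generators (a finite number, by `minimalGenerators_finite`). -/
noncomputable def embeddingDim (S : NumericalSemigroup) : ℕ := S.minimalGenerators.ncard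

theorem exists_conductor (S : NumericalSemigroup) :
    ∃ c : ℕ, ∀ n : ℕ, c ≤ n → n ∈ S.elements := by
  obtain ⟨b, hb⟩ := S.finite_compl.bddAbove
  refine ⟨b + 1, fun n hn => ?_⟩
  by_contra h
  have := hb (show n ∈ (S.carrier)ᶜ from h)
  omega

theorem mem_of_conductor_le (S : NumericalSemigroup) {n : ℕ} (hn : S.conductor ≤ n) :
    n ∈ S.elements :=
  Nat.sInf_mem (s := {c : ℕ | ∀ n : ℕ, c ≤ n → n ∈ S.elements}) S.exists_conductor n hn

/-- The conductor is the unique integer `c` with `c - 1 ∉ S` and `c + ℕ ⊆ S`. -/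
theorem eq_conductor_iff (S : NumericalSemigroup) (c : ℤ) :
    c = S.conductor ↔
      (∀ n ∈ S.elements, (n : ℤ) ≠ c - 1) ∧
        ∀ k : ℕ, ∃ n ∈ S.elements, (n : ℤ) = c + k := by
  constructor
  · rintro rfl
    refine ⟨fun n hn h => ?_, fun k => ⟨S.conductor + k, S.mem_of_conductor_le (by omega),
      by push_cast; rfl⟩⟩
    have : S.conductor ≤ n := Nat.sInf_le (fun m hm => by
      rcases Nat.eq_or_lt_of_le hm with rfl | hlt
      · exact hn
      · exact S.mem_of_conductor_le (by omega))
    omega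
  · rintro ⟨h1, h2⟩
    have hc : 0 ≤ c := by
      obtain ⟨n, -, hn⟩ := h2 0
      push_cast at hn
      omega
    lift c to ℕ using hc
    have hle : S.conductor ≤ c := Nat.sInf_le (fun m hm => by
      obtain ⟨n, hn, hnm⟩ := h2 (m - c)
      have : n = m := by omega
      exact this ▸ hn)
    by_contra hne
    have hlt : S.conductor < c := by omega
    exact h1 (c - 1) (S.mem_of_conductor_le (by omega)) (by omega)

/-- The minimal generators form the least set generating `S`. -/
theorem minimalGenerators_isLeast (S : NumericalSemigroup) :
    IsLeast {A : Set ℕ | AddSubmonoid.closure A = S.toAddSubmonoid} S.minimalGenerators := by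
  constructor
  · apply le_antisymm
    · exact (AddSubmonoid.closure_le).2 fun a ha => ha.1
    · intro a
      induction a using Nat.strong_induction_on with
      | _ a ih =>
        intro ha
        by_cases h0 : a = 0
        · subst h0
          exact zero_mem _
        by_cases hm : a ∈ S.minimalGenerators
        · exact AddSubmonoid.subset_closure hm
        · have : ∃ x ∈ S.elements, ∃ y ∈ S.elements, x ≠ 0 ∧ y ≠ 0 ∧ x + y = a := by
            by_contra hcon
            exact hm ⟨ha, h0, fun x hx y hy hx0 hy0 hxy =>
              hcon ⟨x, hx, y, hy, hx0, hy0, hxy⟩⟩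
          obtain ⟨x, hx, y, hy, hx0, hy0, rfl⟩ := this
          exact add_mem (ih x (by omega) hx) (ih y (by omega) hy)
  · intro A hA a ha
    have hA' : AddSubmonoid.closure A = S.toAddSubmonoid := hA
    have key : ∀ b ∈ AddSubmonoid.closure A, b ∈ S.minimalGenerators → b ∈ A := by
      intro b hb
      induction hb using AddSubmonoid.closure_induction with
      | mem x hx => exact fun _ => hx
      | zero => exact fun h => absurd rfl h.2.1
      | add x y hx hy ihx ihy =>
        intro h
        by_cases hx0 : x = 0
        · subst hx0
          rw [zero_add] at h ⊢
          exact ihy h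
        by_cases hy0 : y = 0
        · subst hy0
          rw [add_zero] at h ⊢
          exact ihx h
        rw [hA'] at hx hy
        exact absurd rfl (h.2.2 x hx y hy hx0 hy0)
    exact key a (hA' ▸ ha.1) ha

theorem minimalGenerators_finite (S : NumericalSemigroup) : S.minimalGenerators.Finite := by
  refine (Set.finite_Iio (2 * S.conductor + 2)).subset fun a ha => ?_
  by_contra h
  have h' : 2 * S.conductor + 2 ≤ a := not_lt.1 h
  exact ha.2.2 (S.conductor + 1) (S.mem_of_conductor_le (by omega))
    (a - (S.conductor + 1)) (S.mem_of_conductor_le (by omega)) (by omega) (by omega) (by omega)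

end NumericalSemigroup

/-! Let `c` be the conductor, `m` the multiplicity and `L = c - g` the number of elements of `S`
below `c`; Wilf's inequality reads `c ≤ e * L`. If `a < c` lies in `S`, then `c - 1 - a` is a gap,
so `L ≤ g` and `c ≤ 2 * g ≤ 100`. This leaves finitely many pairs `(c, m)`. If `0 < c ≤ m`, every
element of `[c, c + m)` is a minimal generator and `e ≥ m ≥ c`. Otherwise `m ≤ c - 2`, and `S` is
determined by `c` and its left generators, those below `c`. If there are `p` of them, then `e` is at
least `p` plus the number of elements of `[c, c + m)` outside their span
(`card_lowGens_add_le_embeddingDim`).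

For each such pair a tree search picks the left generators in increasing order. A branch is cut once
all its proper completions satisfy the inequality by a crude bound. With `r` further left
generators, all at least `y`, `L` is at least its current value plus `r`, and at least `c - 50`. The
new span meets `[c, c + m)` in no more elements than a set covering it modulo `m` has below `c + m`
(`Covers.count_le`). Such a cover arises from the Apéry set of the current span by adding multiples
of the new generators, and replacing each of them by `y` can only raise the bound on its size
(`exists_covers_closure_union`). So at a given node the bound depends on `r` alone
(`prune_lowSpan_sound`).

Subsets of `[0, c + m)` are stored as base 256 numerals: translation is a shift, cardinality a
residue modulo 255. The kernel evaluates the search, and `search_sound` turns the outcome into the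
inequality. -/

namespace WilfSearch

/-- `eager n k` is `k n`; weak head reduction evaluates `n` before it enters `k`. -/
noncomputable def eager {α : Type} (n : ℕ) (k : ℕ → α) : α :=
  Nat.rec (motive := fun _ => α) (k 0) (fun n _ => k (Nat.succ n)) n

/-- A conditional that reduces in one step. -/
noncomputable def select {α : Type} (b : Bool) (x y : α) : α :=
  Bool.rec (motive := fun _ => α) y x b

theorem eager_eq {α : Type} (n : ℕ) (k : ℕ → α) : eager n k = k n := by
  cases n <;> rfl

theorem select_eq {α : Type} (b : Bool) (x y : α) : select b x y = if b then x else y := by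
  cases b <;> rfl

/-! ### Sequences and sets as base 256 numerals -/

/-- The number whose base 256 digits, most significant first, are `b 0, …, b (n - 1)`. -/
def digits (b : ℕ → ℕ) : ℕ → ℕ
  | 0 => 0
  | n + 1 => 256 * digits b n + b n

/-- The sum of `b 0, …, b (n - 1)`. -/
def count (b : ℕ → ℕ) (n : ℕ) : ℕ := ∑ i ∈ Finset.range n, b i

theorem count_succ (b : ℕ → ℕ) (n : ℕ) : count b (n + 1) = count b n + b n :=
  Finset.sum_range_succ b n

theorem count_mono (b : ℕ → ℕ) {m n : ℕ} (h : m ≤ n) : count b m ≤ count b n :=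
  Finset.sum_le_sum_of_subset (Finset.range_mono h)

theorem le_count (b : ℕ → ℕ) {i n : ℕ} (h : i < n) : b i ≤ count b n :=
  Finset.single_le_sum (f := b) (fun _ _ => Nat.zero_le _) (Finset.mem_range.2 h)

theorem digits_congr {a b : ℕ → ℕ} {n : ℕ} (h : ∀ i < n, a i = b i) :
    digits a n = digits b n := by
  induction n with
  | zero => rfl
  | succ n ih => rw [digits, digits, ih fun i hi => h i (by omega), h n (by omega)]

/-- Since 256 is 1 modulo 255, a numeral is congruent to its digit sum. -/
theorem digits_mod (b : ℕ → ℕ) (n : ℕ) : digits b n % 255 = count b n % 255 := by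
  induction n with
  | zero => rfl
  | succ n ih => rw [digits, count_succ]; omega

theorem digits_add (a b : ℕ → ℕ) (n : ℕ) :
    digits a n + digits b n = digits (fun i => a i + b i) n := by
  induction n with
  | zero => rfl
  | succ n ih => simp only [digits, ← ih]; ring

/-- Dropping low digits truncates the sequence. Index 0 is the most significant digit, so by
`digits_delay` the same shift is a translation by `y`, cut off at length `n`. -/
theorem digits_shiftRight {b : ℕ → ℕ} {n : ℕ} (h : ∀ i < n, b i < 256) (y : ℕ) :
    digits b n >>> (8 * y) = digits b (n - y) := by
  induction y with
  | zero => rfl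
  | succ y ih =>
    rw [Nat.mul_succ, Nat.shiftRight_add, ih, Nat.shiftRight_eq_div_pow]
    rcases Nat.lt_or_ge y n with hy | hy
    · obtain ⟨k, hk⟩ : ∃ k, n - y = k + 1 := ⟨n - y - 1, by omega⟩
      have := h k (by omega)
      rw [hk, show n - (y + 1) = k by omega, digits]
      omega
    · rw [show n - y = 0 by omega, show n - (y + 1) = 0 by omega]
      simp [digits]

/-- The sequence `b` delayed by `y`. -/
def delay (y : ℕ) (b : ℕ → ℕ) (i : ℕ) : ℕ := if y ≤ i then b (i - y) else 0

theorem digits_delay (y : ℕ) (b : ℕ → ℕ) (n : ℕ) : digits (delay y b) n = digits b (n - y) := by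
  induction n with
  | zero => simp [digits]
  | succ n ih =>
    rw [digits, ih, delay]
    split_ifs with h
    · rw [show n + 1 - y = n - y + 1 by omega, digits]
    · rw [show n + 1 - y = 0 by omega, show n - y = 0 by omega]
      rfl

theorem count_delay (y : ℕ) (b : ℕ → ℕ) (n : ℕ) : count (delay y b) n = count b (n - y) := by
  induction n with
  | zero => simp [count]
  | succ n ih =>
    rw [count_succ, ih, delay]
    split_ifs with h
    · rw [show n + 1 - y = n - y + 1 by omega, count_succ]
    · rw [show n + 1 - y = 0 by omega, show n - y = 0 by omega, add_zero]

theorem digits_lor {a b : ℕ → ℕ} (ha : ∀ i, a i < 256) (hb : ∀ i, b i < 256) (n : ℕ) :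
    digits a n ||| digits b n = digits (fun i => a i ||| b i) n := by
  induction n with
  | zero => simp [digits]
  | succ n ih =>
    have hab : a n ||| b n < 2 ^ 8 := Nat.or_lt_two_pow (ha n) (hb n)
    simp only [digits, ← ih, show (256 : ℕ) = 2 ^ 8 from rfl] at *
    refine Nat.eq_of_testBit_eq fun j => ?_
    rw [Nat.testBit_or, Nat.testBit_two_pow_mul_add _ (ha n), Nat.testBit_two_pow_mul_add _ (hb n),
      Nat.testBit_two_pow_mul_add _ hab]
    split_ifs <;> rw [Nat.testBit_or]

theorem digits_land {a b : ℕ → ℕ} (ha : ∀ i, a i < 256) (hb : ∀ i, b i < 256) (n : ℕ) :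
    digits a n &&& digits b n = digits (fun i => a i &&& b i) n := by
  induction n with
  | zero => simp [digits]
  | succ n ih =>
    have hab : a n &&& b n < 2 ^ 8 := Nat.and_lt_two_pow _ (hb n)
    simp only [digits, ← ih, show (256 : ℕ) = 2 ^ 8 from rfl] at *
    refine Nat.eq_of_testBit_eq fun j => ?_
    rw [Nat.testBit_and, Nat.testBit_two_pow_mul_add _ (ha n),
      Nat.testBit_two_pow_mul_add _ (hb n), Nat.testBit_two_pow_mul_add _ hab]
    split_ifs <;> rw [Nat.testBit_and]

theorem digits_xor {a b : ℕ → ℕ} (ha : ∀ i, a i < 256) (hb : ∀ i, b i < 256) (n : ℕ) :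
    digits a n ^^^ digits b n = digits (fun i => a i ^^^ b i) n := by
  induction n with
  | zero => simp [digits]
  | succ n ih =>
    have hab : a n ^^^ b n < 2 ^ 8 := Nat.xor_lt_two_pow (ha n) (hb n)
    simp only [digits, ← ih, show (256 : ℕ) = 2 ^ 8 from rfl] at *
    refine Nat.eq_of_testBit_eq fun j => ?_
    rw [Nat.testBit_xor, Nat.testBit_two_pow_mul_add _ (ha n),
      Nat.testBit_two_pow_mul_add _ (hb n), Nat.testBit_two_pow_mul_add _ hab]
    split_ifs <;> rw [Nat.testBit_xor]

open Classical in
/-- The indicator sequence of a set of natural numbers. -/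
noncomputable def ind (U : Set ℕ) (i : ℕ) : ℕ := if i ∈ U then 1 else 0

theorem ind_of_mem {U : Set ℕ} {i : ℕ} (h : i ∈ U) : ind U i = 1 := if_pos h

theorem ind_of_not_mem {U : Set ℕ} {i : ℕ} (h : i ∉ U) : ind U i = 0 := if_neg h

theorem ind_le_one (U : Set ℕ) (i : ℕ) : ind U i ≤ 1 := by
  rw [ind]; split_ifs <;> omega

theorem ind_lt (U : Set ℕ) (i : ℕ) : ind U i < 256 := by
  have := ind_le_one U i
  omega

theorem count_ind_le (U : Set ℕ) (n : ℕ) : count (ind U) n ≤ n := by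
  induction n with
  | zero => simp [count]
  | succ n ih =>
    have := ind_le_one U n
    rw [count_succ]
    omega

open Classical in
theorem count_ind (U : Set ℕ) (n : ℕ) :
    count (ind U) n = ((Finset.range n).filter (· ∈ U)).card := by
  simp only [count, ind, Finset.card_filter]

theorem digits_ind_mod {U : Set ℕ} {n : ℕ} (hn : n < 255) :
    digits (ind U) n % 255 = count (ind U) n := by
  rw [digits_mod, Nat.mod_eq_of_lt ((count_ind_le U n).trans_lt hn)]

/-- Membership of `y` in the set that `X` encodes. -/
noncomputable def mem (N X y : ℕ) : Bool :=
  Nat.beq (Nat.mod (Nat.shiftRight X (Nat.mul 8 (Nat.sub N (Nat.succ y)))) 2) 1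

/-- After the shift the digit of `y` is the last one and the others contribute a multiple of 256, so
parity decides. -/
theorem mem_eq_true_iff {U : Set ℕ} {N y : ℕ} (hy : y < N) :
    mem N (digits (ind U) N) y = true ↔ y ∈ U := by
  have h : digits (ind U) N >>> (8 * (N - (y + 1))) = digits (ind U) (y + 1) := by
    rw [digits_shiftRight fun i _ => ind_lt U i]
    congr 1
    omega
  have e : mem N (digits (ind U) N) y
      = Nat.beq ((digits (ind U) N >>> (8 * (N - (y + 1)))) % 2) 1 := rfl
  rw [e, Nat.beq_eq, h, digits]
  by_cases hyU : y ∈ U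
  · rw [ind_of_mem hyU]
    exact iff_of_true (by omega) hyU
  · rw [ind_of_not_mem hyU]
    exact iff_of_false (by omega) hyU

/-- Closes the set that `X` encodes under at most `fuel` additions of `y`. -/
noncomputable def extend (y X fuel : ℕ) : ℕ :=
  Nat.rec (motive := fun _ => ℕ) X
    (fun _ T => Nat.lor X (Nat.shiftRight T (Nat.mul 8 y))) fuel

/-- A Horner scheme: each pass translates by `y` and joins `U` again. -/
theorem extend_eq (U : Set ℕ) (N y k : ℕ) :
    extend y (digits (ind U) N) k
      = digits (ind {i | ∃ j ≤ k, ∃ u ∈ U, i = u + j * y}) N := by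
  induction k with
  | zero => simp [extend]
  | succ k ih =>
    have e : extend y (digits (ind U) N) (k + 1)
        = digits (ind U) N ||| (extend y (digits (ind U) N) k >>> (8 * y)) := rfl
    have hd (V : Set ℕ) : delay y (ind V) = ind {i | ∃ v ∈ V, i = v + y} := by
      funext i
      by_cases h : ∃ v ∈ V, i = v + y
      · obtain ⟨v, hv, rfl⟩ := h
        rw [ind_of_mem (by exact ⟨v, hv, rfl⟩), delay, if_pos (by omega), Nat.add_sub_cancel,
          ind_of_mem hv]
      · rw [ind_of_not_mem (by exact h), delay]
        split_ifs with hy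
        · exact ind_of_not_mem fun hv => h ⟨i - y, hv, by omega⟩
        · rfl
    rw [e, ih, digits_shiftRight fun i _ => ind_lt _ i, ← digits_delay, hd,
      digits_lor (ind_lt _) (ind_lt _)]
    congr 1
    funext i
    by_cases h1 : i ∈ U
    · rw [ind_of_mem h1, ind_of_mem (U := {i | ∃ j ≤ k + 1, ∃ u ∈ U, i = u + j * y})
        ⟨0, by omega, i, h1, by omega⟩]
      rcases Nat.le_one_iff_eq_zero_or_eq_one.1 (ind_le_one _ i) with h | h <;> rw [h] <;> rfl
    · rw [ind_of_not_mem h1, Nat.zero_or]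
      by_cases h2 : ∃ j ≤ k + 1, ∃ u ∈ U, i = u + j * y
      · rw [ind_of_mem (U := {i | ∃ j ≤ k + 1, ∃ u ∈ U, i = u + j * y}) h2]
        obtain ⟨j, hj, u, hu, rfl⟩ := h2
        apply ind_of_mem
        obtain _ | j := j
        · exact absurd (by simpa using hu) h1
        · exact ⟨u + j * y, ⟨j, by omega, u, hu, rfl⟩, by ring⟩
      · rw [ind_of_not_mem (U := {i | ∃ j ≤ k + 1, ∃ u ∈ U, i = u + j * y}) h2]
        refine ind_of_not_mem ?_
        rintro ⟨v, ⟨j, hj, u, hu, rfl⟩, rfl⟩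
        exact h2 ⟨j + 1, by omega, u, hu, by ring⟩

/-- The elements of `U` that are not of the form `u + m` with `u ∈ U`. -/
def apery (m : ℕ) (U : Set ℕ) : Set ℕ := {i | i ∈ U ∧ ∀ u ∈ U, i ≠ u + m}

/-- The code of the Apéry set of the set that `X` encodes. -/
noncomputable def aperyCode (m X : ℕ) : ℕ :=
  Nat.xor X (Nat.land X (Nat.shiftRight X (Nat.mul 8 m)))

theorem aperyCode_eq (U : Set ℕ) (N m : ℕ) :
    aperyCode m (digits (ind U) N) = digits (ind (apery m U)) N := by
  have e : aperyCode m (digits (ind U) N)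
      = digits (ind U) N ^^^ (digits (ind U) N &&& (digits (ind U) N >>> (8 * m))) := rfl
  have hd : ∀ i, delay m (ind U) i < 256 := fun i => by
    rw [delay]
    split_ifs
    · exact ind_lt _ _
    · omega
  rw [e, digits_shiftRight fun i _ => ind_lt _ i, ← digits_delay, digits_land (ind_lt _) hd,
    digits_xor (ind_lt _) fun i => Nat.and_lt_two_pow (n := 8) _ (hd i)]
  congr 1
  funext i
  by_cases h1 : i ∈ U
  · rw [ind_of_mem h1, delay]
    split_ifs with hm
    · by_cases h2 : i - m ∈ U
      · rw [ind_of_mem h2, ind_of_not_mem]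
        · rfl
        · exact fun h => h.2 _ h2 (by omega)
      · rw [ind_of_not_mem h2, ind_of_mem]
        · rfl
        · exact ⟨h1, fun u hu h => h2 (by rwa [h, Nat.add_sub_cancel])⟩
    · rw [ind_of_mem]
      · rfl
      · exact ⟨h1, fun u hu h => hm (by omega)⟩
  · rw [ind_of_not_mem h1, Nat.zero_and, ind_of_not_mem fun h => h1 h.1]
    rfl

/-- The digit sequence `b + delay y b + delay (2 * y) b + …`, with `fuel` delays. -/
noncomputable def convolve (y B fuel : ℕ) : ℕ :=
  Nat.rec (motive := fun _ => ℕ) B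
    (fun _ T => Nat.add B (Nat.shiftRight T (Nat.mul 8 y))) fuel

/-- The sequence `b + delay y b + … + delay (k * y) b`. -/
def delaySum (y : ℕ) (b : ℕ → ℕ) : ℕ → ℕ → ℕ
  | 0 => b
  | k + 1 => fun i => b i + delay y (delaySum y b k) i

theorem count_delaySum_succ (y : ℕ) (b : ℕ → ℕ) (k n : ℕ) :
    count (delaySum y b (k + 1)) n = count b n + count (delaySum y b k) (n - y) := by
  rw [← count_delay, count, count, count, ← Finset.sum_add_distrib]
  rfl

theorem count_delaySum_le (y : ℕ) (b : ℕ → ℕ) (k n : ℕ) :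
    count (delaySum y b k) n ≤ count b n * (k + 1) := by
  induction k generalizing n with
  | zero => simp [delaySum]
  | succ k ih =>
    rw [count_delaySum_succ]
    have h1 := ih (n - y)
    have h2 := Nat.mul_le_mul_right (k + 1) (count_mono b (Nat.sub_le n y))
    linarith

/-- Here the translates are added, not joined, so multiplicities count. The bound on the total keeps
each digit below 256, hence no carries occur. -/
theorem convolve_eq {b : ℕ → ℕ} {N y k : ℕ} (h : count b N * (k + 1) < 255) :
    convolve y (digits b N) k = digits (delaySum y b k) N := by
  induction k with
  | zero => rfl
  | succ k ih =>
    have h' : count b N * (k + 1) < 255 := by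
      rw [Nat.mul_succ] at h
      omega
    have e : convolve y (digits b N) (k + 1)
        = digits b N + (convolve y (digits b N) k >>> (8 * y)) := rfl
    have hlt : ∀ i < N, delaySum y b k i < 256 := fun i hi => by
      have h1 := le_count (delaySum y b k) hi
      have h2 := count_delaySum_le y b k N
      omega
    rw [e, ih h', digits_shiftRight hlt, ← digits_delay, digits_add]
    rfl

end WilfSearch

namespace WilfSearch

open Classical in
theorem count_ind_add (W : Set ℕ) (c m : ℕ) :
    count (ind W) (c + m)
      = count (ind W) c + ((Finset.Ico c (c + m)).filter (· ∈ W)).card := by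
  simp only [count, ind, Finset.card_filter, Finset.range_eq_Ico]
  exact (Finset.sum_Ico_consecutive _ (Nat.zero_le c) (Nat.le_add_right c m)).symm

end WilfSearch

/-! ### Left generators, genus and embedding dimension -/

namespace NumericalSemigroup

open WilfSearch

open Classical in
/-- The minimal generators below `n`. -/
noncomputable def lowGens (S : NumericalSemigroup) (n : ℕ) : Finset ℕ :=
  (Finset.range n).filter (· ∈ S.minimalGenerators)

/-- The submonoid generated by the minimal generators below `n`. -/
noncomputable def lowSpan (S : NumericalSemigroup) (n : ℕ) : AddSubmonoid ℕ :=
  AddSubmonoid.closure (S.lowGens n)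

theorem mem_lowGens {S : NumericalSemigroup} {n a : ℕ} :
    a ∈ S.lowGens n ↔ a < n ∧ a ∈ S.minimalGenerators := by
  simp [lowGens]

theorem lowGens_mono (S : NumericalSemigroup) {m n : ℕ} (h : m ≤ n) :
    S.lowGens m ⊆ S.lowGens n := fun a ha => by
  rw [mem_lowGens] at ha ⊢
  exact ⟨by omega, ha.2⟩

theorem mem_elements_of_mem_lowSpan {S : NumericalSemigroup} {n a : ℕ} (h : a ∈ S.lowSpan n) :
    a ∈ S.elements := by
  have : S.lowSpan n ≤ S.toAddSubmonoid :=
    (AddSubmonoid.closure_le).2 fun a ha => (mem_lowGens.1 ha).2.1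
  exact this h

theorem not_mem_minimalGenerators_of_mem_lowSpan {S : NumericalSemigroup} {n a : ℕ}
    (h : a ∈ S.lowSpan n) (ha : n ≤ a) : a ∉ S.minimalGenerators := by
  have key : ∀ b ∈ AddSubmonoid.closure (S.lowGens n : Set ℕ),
      b ∈ S.minimalGenerators → b ∈ S.lowGens n := by
    intro b hb
    induction hb using AddSubmonoid.closure_induction with
    | mem x hx => exact fun _ => hx
    | zero => exact fun h => absurd rfl h.2.1
    | add x y hx hy ihx ihy =>
      intro h
      by_cases hx0 : x = 0
      · subst hx0
        rw [zero_add] at h ⊢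
        exact ihy h
      by_cases hy0 : y = 0
      · subst hy0
        rw [add_zero] at h ⊢
        exact ihx h
      exact absurd rfl (h.2.2 x (mem_elements_of_mem_lowSpan hx) y
        (mem_elements_of_mem_lowSpan hy) hx0 hy0)
  intro hg
  have := (mem_lowGens.1 (key a h hg)).1
  omega

theorem mem_lowSpan_of_lt {S : NumericalSemigroup} {n a : ℕ} (ha : a ∈ S.elements)
    (hn : a < n) : a ∈ S.lowSpan n := by
  induction a using Nat.strong_induction_on with
  | _ a ih =>
    by_cases h0 : a = 0
    · subst h0
      exact zero_mem _
    by_cases hm : a ∈ S.minimalGenerators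
    · exact AddSubmonoid.subset_closure (mem_lowGens.2 ⟨hn, hm⟩)
    · have : ∃ x ∈ S.elements, ∃ y ∈ S.elements, x ≠ 0 ∧ y ≠ 0 ∧ x + y = a := by
        by_contra hcon
        exact hm ⟨ha, h0, fun x hx y hy hx0 hy0 hxy => hcon ⟨x, hx, y, hy, hx0, hy0, hxy⟩⟩
      obtain ⟨x, hx, y, hy, hx0, hy0, rfl⟩ := this
      exact add_mem (ih x (by omega) hx (by omega)) (ih y (by omega) hy (by omega))

theorem lowGens_succ_of_mem {S : NumericalSemigroup} {n : ℕ} (h : n ∈ S.minimalGenerators) :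
    S.lowGens (n + 1) = insert n (S.lowGens n) := by
  ext a
  simp only [mem_lowGens, Finset.mem_insert]
  constructor
  · rintro ⟨h1, h2⟩
    by_cases hn : a = n
    · exact Or.inl hn
    · exact Or.inr ⟨by omega, h2⟩
  · rintro (rfl | ⟨h1, h2⟩)
    · exact ⟨by omega, h⟩
    · exact ⟨by omega, h2⟩

theorem lowGens_succ_of_not_mem {S : NumericalSemigroup} {n : ℕ}
    (h : n ∉ S.minimalGenerators) : S.lowGens (n + 1) = S.lowGens n := by
  ext a
  simp only [mem_lowGens]
  constructor
  · rintro ⟨h1, h2⟩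
    exact ⟨lt_of_le_of_ne (by omega) (by rintro rfl; exact h h2), h2⟩
  · rintro ⟨h1, h2⟩
    exact ⟨by omega, h2⟩

theorem mem_closure_insert_iff {A : Set ℕ} {a w : ℕ} :
    w ∈ AddSubmonoid.closure (insert a A) ↔
      ∃ j, ∃ u ∈ AddSubmonoid.closure A, w = u + j * a := by
  rw [← Set.union_singleton, AddSubmonoid.closure_union, AddSubmonoid.mem_sup]
  constructor
  · rintro ⟨u, hu, z, hz, rfl⟩
    obtain ⟨j, rfl⟩ := AddSubmonoid.mem_closure_singleton.1 hz
    exact ⟨j, u, hu, by rw [smul_eq_mul]⟩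
  · rintro ⟨j, u, hu, rfl⟩
    exact ⟨u, hu, j * a, AddSubmonoid.mem_closure_singleton.2 ⟨j, smul_eq_mul ..⟩, rfl⟩

theorem count_elements_add_genus (S : NumericalSemigroup) :
    count (ind S.elements) S.conductor + S.genus = S.conductor := by
  classical
  have h : S.elementsᶜ = ↑((Finset.range S.conductor).filter (· ∉ S.elements)) := by
    ext a
    simp only [Set.mem_compl_iff, Finset.coe_filter, Finset.mem_range, Set.mem_ofPred_eq]
    refine ⟨fun ha => ⟨?_, ha⟩, fun ha => ha.2⟩
    by_contra hc
    exact ha (S.mem_of_conductor_le (not_lt.1 hc))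
  rw [genus, h, Set.ncard_coe_finset, count_ind]
  convert Finset.card_filter_add_card_filter_not (s := Finset.range S.conductor)
    (· ∈ S.elements)
  simp

theorem conductor_sub_one_not_mem {S : NumericalSemigroup} (h : 0 < S.conductor) :
    S.conductor - 1 ∉ S.elements := fun hc => by
  refine ((S.eq_conductor_iff S.conductor).1 rfl).1 _ hc ?_
  omega

/-- The reflection `i ↦ c - 1 - i` sends elements to gaps, because `c - 1` is a gap. -/
theorem count_elements_le_genus (S : NumericalSemigroup) :
    count (ind S.elements) S.conductor ≤ S.genus := by
  classical
  rw [count_ind, genus, ← Set.ncard_coe_finset]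
  refine Set.ncard_le_ncard_of_injOn (fun i => S.conductor - 1 - i) ?_ ?_ S.finite_compl
  · intro i hi hc
    simp only [Finset.coe_filter, Finset.mem_range, Set.mem_ofPred_eq] at hi
    refine conductor_sub_one_not_mem (S := S) (by omega) ?_
    have : i + (S.conductor - 1 - i) ∈ S.toAddSubmonoid := add_mem hi.2 hc
    rwa [show i + (S.conductor - 1 - i) = S.conductor - 1 by omega] at this
  · intro i hi j hj hij
    simp only [Finset.coe_filter, Finset.mem_range, Set.mem_ofPred_eq] at hi hj hij
    omega

theorem count_lowSpan_conductor (S : NumericalSemigroup) :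
    count (ind (S.lowSpan S.conductor)) S.conductor = count (ind S.elements) S.conductor := by
  refine Finset.sum_congr rfl fun i hi => ?_
  by_cases h : i ∈ S.elements
  · rw [ind_of_mem h, ind_of_mem]
    exact mem_lowSpan_of_lt h (Finset.mem_range.1 hi)
  · rw [ind_of_not_mem h, ind_of_not_mem]
    exact fun hc => h (mem_elements_of_mem_lowSpan hc)

/-- The minimal generators from the conductor `c` on include the elements of `[c, c + m)` that
the smaller ones do not generate. -/
theorem card_lowGens_add_le_embeddingDim (S : NumericalSemigroup) {m : ℕ}
    (hm : ∀ s ∈ S.elements, s ≠ 0 → m ≤ s) :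
    (S.lowGens S.conductor).card + (m + count (ind (S.lowSpan S.conductor)) S.conductor
      - count (ind (S.lowSpan S.conductor)) (S.conductor + m)) ≤ S.embeddingDim := by
  classical
  set c := S.conductor with hc
  set W : Set ℕ := (S.lowSpan c : Set ℕ) with hW
  set F := (Finset.Ico c (c + m)).filter (· ∉ W) with hF
  have hFc : F.card = m + count (ind W) c - count (ind W) (c + m) := by
    have h1 := count_ind_add W c m
    have h2 : ((Finset.Ico c (c + m)).filter (· ∈ W)).card + F.card = c + m - c := by
      rw [hF, ← Nat.card_Ico]
      exact Finset.card_filter_add_card_filter_not (· ∈ W)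
    omega
  have hd : Disjoint (S.lowGens c) F := by
    refine Finset.disjoint_left.2 fun a ha hb => ?_
    have h1 := (mem_lowGens.1 ha).1
    have h2 := (Finset.mem_Ico.1 (Finset.mem_filter.1 hb).1).1
    omega
  rw [← hFc, ← Finset.card_union_of_disjoint hd, embeddingDim, ← Set.ncard_coe_finset]
  refine Set.ncard_le_ncard ?_ S.minimalGenerators_finite
  intro a ha
  rcases Finset.mem_union.1 (Finset.mem_coe.1 ha) with ha | ha
  · exact (mem_lowGens.1 ha).2
  · obtain ⟨h1, h2⟩ := Finset.mem_filter.1 ha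
    rw [Finset.mem_Ico] at h1
    refine ⟨S.mem_of_conductor_le h1.1, ?_, fun x hx y hy hx0 hy0 hxy => h2 ?_⟩
    · rintro rfl
      exact h2 (zero_mem (S.lowSpan c))
    -- Both summands are at least `m` and their sum is below `c + m`, so both are below `c`.
    · have hxm := hm x hx hx0
      have hym := hm y hy hy0
      have hxc : x ∈ S.lowSpan c := mem_lowSpan_of_lt hx (by omega)
      have hyc : y ∈ S.lowSpan c := mem_lowSpan_of_lt hy (by omega)
      exact hxy ▸ add_mem hxc hyc

end NumericalSemigroup

/-! ### Covers modulo the multiplicity and domination of prefix counts -/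

namespace WilfSearch

/-- Every element of `W` exceeds an element of `V` by a multiple of `m`. -/
def Covers (m : ℕ) (V W : Set ℕ) : Prop := ∀ w ∈ W, ∃ v ∈ V, ∃ k, w = v + k * m

theorem covers_apery {m : ℕ} (hm : 0 < m) (W : Set ℕ) : Covers m (apery m W) W := by
  intro w
  induction w using Nat.strong_induction_on with
  | _ w ih =>
    intro hw
    by_cases h : ∃ u ∈ W, w = u + m
    · obtain ⟨u, hu, rfl⟩ := h
      obtain ⟨v, hv, k, rfl⟩ := ih u (by omega) hu
      exact ⟨v, hv, k + 1, by ring⟩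
    · exact ⟨w, ⟨hw, fun u hu he => h ⟨u, hu, he⟩⟩, 0, by omega⟩

/-- Two elements of `[c, c + m)` over the same `v` differ by a multiple of `m` smaller than `m`, so
they coincide. -/
theorem Covers.count_le {m : ℕ} {V W : Set ℕ} (h : Covers m V W) (c : ℕ) :
    count (ind W) (c + m) ≤ count (ind W) c + count (ind V) (c + m) := by
  classical
  rw [count_ind_add, count_ind V]
  refine Nat.add_le_add_left ?_ _
  choose! f hf g hg using h
  refine Finset.card_le_card_of_injOn f ?_ ?_
  · intro w hw
    obtain ⟨hw1, hw2⟩ := Finset.mem_filter.1 (Finset.mem_coe.1 hw)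
    have := hg w hw2
    rw [Finset.mem_Ico] at hw1
    exact Finset.mem_coe.2 (Finset.mem_filter.2 ⟨Finset.mem_range.2 (by omega), hf w hw2⟩)
  · intro w hw w' hw' hfw
    obtain ⟨hw1, hw2⟩ := Finset.mem_filter.1 (Finset.mem_coe.1 hw)
    obtain ⟨hw1', hw2'⟩ := Finset.mem_filter.1 (Finset.mem_coe.1 hw')
    rw [Finset.mem_Ico] at hw1 hw1'
    have e := hg w hw2
    have e' := hg w' hw2'
    rw [← hfw] at e'
    have hk : g w = g w' := by
      rcases lt_trichotomy (g w) (g w') with hlt | heq | hlt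
      · have := Nat.mul_le_mul_right m hlt
        rw [Nat.succ_mul] at this
        omega
      · exact heq
      · have := Nat.mul_le_mul_right m hlt
        rw [Nat.succ_mul] at this
        omega
    rw [e, e', hk]

/-- The sums of an element of `V` and a multiple of `y`. -/
def addMultiples (y : ℕ) (V : Set ℕ) : Set ℕ := {i | ∃ j, ∃ v ∈ V, i = v + j * y}

theorem count_addMultiples_le (V : Set ℕ) {y n : ℕ} :
    count (ind (addMultiples y V)) n
      ≤ count (ind V) n + count (ind (addMultiples y V)) (n - y) := by
  rw [← count_delay, count, count, count, ← Finset.sum_add_distrib]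
  refine Finset.sum_le_sum fun i _ => ?_
  by_cases h : i ∈ addMultiples y V
  · rw [ind_of_mem h]
    obtain ⟨j, v, hv, rfl⟩ := h
    obtain _ | j := j
    · rw [zero_mul, add_zero, ind_of_mem hv]
      omega
    · have : v + (j + 1) * y = v + j * y + y := by ring
      rw [this, delay, if_pos (by omega), Nat.add_sub_cancel,
        ind_of_mem (U := addMultiples y V) ⟨j, v, hv, rfl⟩]
      omega
  · rw [ind_of_not_mem h]
    exact Nat.zero_le _

/-- Smaller steps move elements to the left, which can only raise prefix counts. Pointwise
domination would fail, which is why all prefixes are compared. -/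
theorem count_addMultiples_le_delaySum {V : Set ℕ} {b : ℕ → ℕ} {x y N : ℕ} (hxy : x ≤ y)
    (hV : ∀ n ≤ N, count (ind V) n ≤ count b n) (k : ℕ) {n : ℕ} (hn : n ≤ N)
    (hk : n ≤ (k + 1) * x) :
    count (ind (addMultiples y V)) n ≤ count (delaySum x b k) n := by
  induction k generalizing n with
  | zero =>
    have h := count_addMultiples_le V (y := y) (n := n)
    rw [show n - y = 0 by omega] at h
    exact h.trans (hV n hn)
  | succ k ih =>
    rw [Nat.succ_mul] at hk
    have h1 := count_addMultiples_le V (y := y) (n := n)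
    have h2 := ih (n := n - x) (by omega) (by omega)
    have h3 := count_mono (ind (addMultiples y V)) (Nat.sub_le_sub_left hxy n)
    have h4 := hV n hn
    rw [count_delaySum_succ]
    omega

/-- The `r`-fold iterate of `delaySum x · k`. -/
def iterDelaySum (x k : ℕ) (b : ℕ → ℕ) : ℕ → ℕ → ℕ
  | 0 => b
  | r + 1 => delaySum x (iterDelaySum x k b r) k

theorem iterDelaySum_succ' (x k : ℕ) (b : ℕ → ℕ) (r : ℕ) :
    iterDelaySum x k b (r + 1) = iterDelaySum x k (delaySum x b k) r := by
  induction r with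
  | zero => rfl
  | succ r ih => rw [iterDelaySum, ih, iterDelaySum]

/-- A cover of the enlarged span suffices; it need not be its Apéry set. Each generator in `R` costs
one `delaySum` with the common lower bound `x` in place of its own step. -/
theorem exists_covers_closure_union {m x k N : ℕ} {A V : Set ℕ} {b : ℕ → ℕ} (hk : N ≤ (k + 1) * x)
    (hA : Covers m V (AddSubmonoid.closure A)) (hV : ∀ n ≤ N, count (ind V) n ≤ count b n)
    (R : Finset ℕ) (hR : ∀ y ∈ R, x ≤ y) :
    ∃ V' : Set ℕ, Covers m V' (AddSubmonoid.closure (↑R ∪ A)) ∧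
      ∀ n ≤ N, count (ind V') n ≤ count (iterDelaySum x k b R.card) n := by
  induction R using Finset.induction_on with
  | empty => exact ⟨V, by simpa using hA, hV⟩
  | insert y R hy ih =>
    obtain ⟨V', h1, h2⟩ := ih fun z hz => hR z (Finset.mem_insert_of_mem hz)
    refine ⟨addMultiples y V', fun w hw => ?_, fun n hn => ?_⟩
    · rw [Finset.coe_insert, Set.insert_union, SetLike.mem_coe,
        NumericalSemigroup.mem_closure_insert_iff] at hw
      obtain ⟨j, u, hu, rfl⟩ := hw
      obtain ⟨v, hv, i, rfl⟩ := h1 u hu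
      exact ⟨v + j * y, ⟨j, v, hv, rfl⟩, i, by ring⟩
    · rw [Finset.card_insert_of_notMem hy]
      exact count_addMultiples_le_delaySum (hR y (Finset.mem_insert_self _ _)) h2 k hn
        (hn.trans hk)

end WilfSearch

/-! ### The search and its pruning test -/

namespace WilfSearch

/-- Whether `c ≤ a * max u v`. -/
noncomputable def enough (c a u v : ℕ) : Bool :=
  select (Nat.ble c (Nat.mul a u)) true (Nat.ble c (Nat.mul a v))

theorem enough_eq_true_iff {c a u v : ℕ} :
    enough c a u v = true ↔ c ≤ a * u ∨ c ≤ a * v := by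
  have e : enough c a u v = select (Nat.ble c (a * u)) true (Nat.ble c (a * v)) := rfl
  rw [e, select_eq]
  by_cases h : c ≤ a * u <;> simp [h]

/-- Whether the inequality holds for all numerical semigroups that have `r` or more left
generators besides the `p` known ones, all of them at least `x`. Here `L` counts the known elements
below the conductor `c`, and `B` encodes a sequence with sum `s` that dominates the Apéry set after
`r - 1` new generators. -/
noncomputable def prune (c m p L K x fuel : ℕ) : ℕ → ℕ → ℕ → Bool :=
  Nat.rec (motive := fun _ => ℕ → ℕ → ℕ → Bool) (fun _ _ _ => false)
    (fun _ ih r s B =>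
      select (enough c (Nat.add p r) (Nat.add L r) (Nat.sub c 50)) true
        (select (Nat.ble 255 (Nat.mul s (Nat.succ K))) false
          (eager (Nat.mod (convolve x B K) 255) fun s' =>
            select (enough c (Nat.add (Nat.add p r) (Nat.sub m s')) (Nat.add L r) (Nat.sub c 50))
              (eager (Nat.succ r) fun r' => ih r' s' (convolve x B K)) false))) fuel

/-- The state at `r` accounts for `r - 1` new generators, so `r + j` of them require `j + 1` further
delay sums. -/
theorem prune_sound {c m p L K x N fuel r : ℕ} {b : ℕ → ℕ}
    (h : prune c m p L K x fuel r (count b N) (digits b N) = true) (j : ℕ) :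
    c ≤ (p + (r + j) + (m - count (iterDelaySum x K b (j + 1)) N)) * (L + (r + j)) ∨
      c ≤ (p + (r + j) + (m - count (iterDelaySum x K b (j + 1)) N)) * (c - 50) := by
  induction fuel generalizing r b j with
  | zero => exact absurd h (by simp [prune])
  | succ fuel ih =>
    have e : prune c m p L K x (fuel + 1) r (count b N) (digits b N)
      = select (enough c (p + r) (L + r) (c - 50)) true
        (select (Nat.ble 255 (count b N * (K + 1))) false
          (eager (convolve x (digits b N) K % 255) fun s' =>
            select (enough c (p + r + (m - s')) (L + r) (c - 50))
              (eager (r + 1) fun r' =>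
                prune c m p L K x fuel r' s' (convolve x (digits b N) K)) false)) := rfl
    rw [e, select_eq] at h
    split_ifs at h with h1
    -- This test ignores the generators from `c` on, and its products grow with `r`; it therefore
    -- settles all larger numbers of generators at once.
    · rcases enough_eq_true_iff.1 h1 with h1 | h1
      · exact Or.inl (h1.trans (Nat.mul_le_mul (by omega) (by omega)))
      · exact Or.inr (h1.trans (Nat.mul_le_mul_right _ (by omega)))
    · rw [select_eq] at h
      split_ifs at h with h2
      have h3 : count b N * (K + 1) < 255 := by
        rw [Nat.ble_eq] at h2
        omega
      have h4 := count_delaySum_le x b K N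
      rw [eager_eq, convolve_eq h3, digits_mod, Nat.mod_eq_of_lt (by omega), select_eq] at h
      split_ifs at h with h5
      rw [eager_eq] at h
      obtain _ | j := j
      · exact enough_eq_true_iff.1 h5
      · have := ih h j
        rwa [← iterDelaySum_succ', show r + 1 + j = r + (j + 1) by omega] at this

/-- Checks the set that `X` encodes, with `p` generators, as the left part of a numerical
semigroup, and goes on with `k`. -/
noncomputable def visit (c m N X p : ℕ) (k : ℕ → Bool) : Bool :=
  select (mem N X (Nat.sub c 1)) true
    (eager (Nat.mod (Nat.shiftRight X (Nat.mul 8 m)) 255) fun L =>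
      select (select
          (Nat.ble c (Nat.mul (Nat.add p (Nat.sub (Nat.add m L) (Nat.mod X 255))) L)) true
          (Nat.ble (Nat.add L 51) c))
        (k L) false)

/-- Runs through the ways to add left generators from `y` on to the set that `X` encodes. -/
noncomputable def loop (c m N fuel : ℕ) : ℕ → ℕ → ℕ → ℕ → ℕ → Bool :=
  Nat.rec (motive := fun _ => ℕ → ℕ → ℕ → ℕ → ℕ → Bool) (fun _ _ _ _ _ => true)
    (fun _ ih X A L p y => eager (Nat.succ y) fun y' =>
      select (mem N X y) (ih X A L p y')
        (select (eager (Nat.div N y) fun K => prune c m p L K y c 1 (Nat.mod A 255) A) true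
          (select (eager (extend y X (Nat.div N y)) fun T => eager (Nat.succ p) fun p' =>
              visit c m N T p' fun L' => ih T (aperyCode m T) L' p' y')
            (ih X A L p y') false))) fuel

/-- The search for the conductor `c` and the multiplicity `m`. -/
noncomputable def search (c m : ℕ) : Bool :=
  eager (Nat.add c m) fun N =>
    eager (extend m (Nat.pow 256 (Nat.sub N 1)) (Nat.div N m)) fun T =>
      visit c m N T 1 fun L =>
        loop c m N (Nat.sub c (Nat.add m 2)) T (aperyCode m T) L 1 (Nat.succ m)

/-- The searches for the conductor `c` and the multiplicities from `2` to `fuel + 1`. -/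
noncomputable def searchConductor (c fuel : ℕ) : Bool :=
  Nat.rec (motive := fun _ => Bool) true
    (fun k ih => select (search c (Nat.succ (Nat.succ k))) ih false) fuel

/-- The searches for the conductors from `c` to `c + fuel - 1`. -/
noncomputable def searchRange (c fuel : ℕ) : Bool :=
  Nat.rec (motive := fun _ => Bool) true
    (fun k ih => select (searchConductor (Nat.add c k) (Nat.sub (Nat.add c k) 3)) ih false) fuel

theorem searchConductor_sound {c fuel : ℕ} (h : searchConductor c fuel = true) {m : ℕ}
    (h1 : 2 ≤ m) (h2 : m < fuel + 2) : search c m = true := by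
  induction fuel with
  | zero => omega
  | succ k ih =>
    have e : searchConductor c (k + 1)
      = select (search c (k + 2)) (searchConductor c k) false := rfl
    rw [e, select_eq] at h
    split_ifs at h with h3
    rcases Nat.lt_or_ge m (k + 2) with hm | hm
    · exact ih h hm
    · rwa [show m = k + 2 by omega]

theorem searchRange_sound {c fuel : ℕ} (h : searchRange c fuel = true) {d m : ℕ}
    (h1 : c ≤ d) (h2 : d < c + fuel) (h3 : 2 ≤ m) (h4 : m + 2 ≤ d) : search d m = true := by
  induction fuel with
  | zero => omega
  | succ k ih =>
    have e : searchRange c (k + 1)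
      = select (searchConductor (c + k) (c + k - 3)) (searchRange c k) false := rfl
    rw [e, select_eq] at h
    split_ifs at h with h5
    rcases Nat.lt_or_ge d (c + k) with hd | hd
    · exact ih h hd
    · rw [show d = c + k by omega]
      exact searchConductor_sound h5 h3 (by omega)

/-! ### Soundness of the search -/

section Soundness

open NumericalSemigroup

variable {S : NumericalSemigroup} {m : ℕ}

/-- The first conclusion settles the node when its left generators are all those of `S`; the second
passes on to the branches that add more. -/
theorem visit_sound (hc : 0 < S.conductor) (hN : S.conductor + m < 255) (hg : S.genus ≤ 50)
    (hm : ∀ s ∈ S.elements, s ≠ 0 → m ≤ s) {y : ℕ} {k : ℕ → Bool}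
    (h : visit S.conductor m (S.conductor + m)
      (digits (ind (S.lowSpan y)) (S.conductor + m)) (S.lowGens y).card k = true) :
    (S.lowGens y = S.lowGens S.conductor →
        S.conductor ≤ S.embeddingDim * count (ind S.elements) S.conductor) ∧
      k (count (ind (S.lowSpan y)) S.conductor) = true := by
  have e (c N X p : ℕ) : visit c m N X p k = select (mem N X (c - 1)) true
    (eager ((X >>> (8 * m)) % 255) fun L =>
      select (select (Nat.ble c ((p + (m + L - X % 255)) * L)) true (Nat.ble (L + 51) c))
        (k L) false) := rfl
  rw [e, select_eq, if_neg, eager_eq, digits_shiftRight fun i _ => ind_lt _ i,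
    Nat.add_sub_cancel, digits_ind_mod (by omega), digits_ind_mod hN, select_eq] at h
  · split_ifs at h with h1
    refine ⟨fun hy => ?_, h⟩
    have hspan : S.lowSpan y = S.lowSpan S.conductor := by rw [lowSpan, hy, lowSpan]
    rw [hy, hspan, count_lowSpan_conductor] at h1
    have he := card_lowGens_add_le_embeddingDim S hm
    rw [count_lowSpan_conductor] at he
    rw [select_eq] at h1
    split_ifs at h1 with h2
    · exact (Nat.le_of_ble_eq_true h2).trans (Nat.mul_le_mul_right _ he)
    -- Here `L ≤ c - 51`, so the genus would be at least 51.
    · have h3 := Nat.le_of_ble_eq_true h1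
      have h4 := count_elements_add_genus S
      omega
  · rw [mem_eq_true_iff (by omega)]
    exact fun hmem => conductor_sub_one_not_mem hc (mem_elements_of_mem_lowSpan hmem)

/-- The missing left generators form a nonempty set `R`, and `prune_sound` is used for `r = 1` and
`j + 1 = R.card`. -/
theorem prune_lowSpan_sound (hm0 : 0 < m) (hg : S.genus ≤ 50)
    (hm : ∀ s ∈ S.elements, s ≠ 0 → m ≤ s) {y : ℕ} (hy : 0 < y) (hyc : y ≤ S.conductor)
    (hne : S.lowGens y ≠ S.lowGens S.conductor)
    (h : prune S.conductor m (S.lowGens y).card (count (ind (S.lowSpan y)) S.conductor)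
      ((S.conductor + m) / y) y S.conductor 1
      (count (ind (apery m (S.lowSpan y))) (S.conductor + m))
      (digits (ind (apery m (S.lowSpan y))) (S.conductor + m)) = true) :
    S.conductor ≤ S.embeddingDim * count (ind S.elements) S.conductor := by
  classical
  set c := S.conductor with hc
  have hsub := S.lowGens_mono hyc
  set R := S.lowGens c \ S.lowGens y with hR
  have hRc : R.card + (S.lowGens y).card = (S.lowGens c).card :=
    Finset.card_sdiff_add_card_eq_card hsub
  obtain ⟨j, hj⟩ : ∃ j, R.card = j + 1 := by
    refine Nat.exists_eq_succ_of_ne_zero fun h0 => hne ?_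
    exact Finset.eq_of_subset_of_card_le hsub (by omega)
  have hRy : ∀ z ∈ R, y ≤ z ∧ z < c ∧ z ∈ S.minimalGenerators := fun z hz => by
    rw [hR, Finset.mem_sdiff, mem_lowGens, mem_lowGens] at hz
    refine ⟨?_, hz.1.1, hz.1.2⟩
    by_contra hlt
    exact hz.2 ⟨by omega, hz.1.2⟩
  obtain ⟨V, hV1, hV2⟩ := exists_covers_closure_union (x := y) (k := (c + m) / y) (N := c + m)
    (by rw [mul_comm]; exact (Nat.lt_mul_div_succ _ hy).le)
    (covers_apery hm0 (S.lowSpan y : Set ℕ)) (fun n _ => le_rfl) R fun z hz => (hRy z hz).1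
  have hcl : AddSubmonoid.closure (↑R ∪ (S.lowGens y : Set ℕ)) = S.lowSpan c := by
    rw [lowSpan, hR, ← Finset.coe_union, Finset.sdiff_union_of_subset hsub]
  rw [hcl] at hV1
  have h1 := hV1.count_le c
  have h2 := hV2 (c + m) le_rfl
  rw [hj] at h2
  have h3 := card_lowGens_add_le_embeddingDim S hm
  have h4 := count_elements_add_genus S
  rw [← hc] at h3 h4
  -- The generators in `R` are elements below `c` that lie outside the current span.
  have h5 : count (ind (S.lowSpan y)) c + R.card ≤ count (ind S.elements) c := by
    rw [count_ind, count_ind, ← Finset.card_union_of_disjoint]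
    · refine Finset.card_le_card fun i hi => ?_
      rw [Finset.mem_filter, Finset.mem_range]
      rcases Finset.mem_union.1 hi with hi | hi
      · rw [Finset.mem_filter, Finset.mem_range] at hi
        exact ⟨hi.1, mem_elements_of_mem_lowSpan hi.2⟩
      · exact ⟨(hRy i hi).2.1, (hRy i hi).2.2.1⟩
    · refine Finset.disjoint_left.2 fun i hi hi' => ?_
      obtain ⟨h6, h7, h8⟩ := hRy i hi'
      exact not_mem_minimalGenerators_of_mem_lowSpan (Finset.mem_filter.1 hi).2 h6 h8
  rcases prune_sound h j with h6 | h6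
  · exact h6.trans (Nat.mul_le_mul (by omega) (by omega))
  · exact h6.trans (Nat.mul_le_mul (by omega) (by omega))

/-- `hne` says that a left generator is still missing; the node without further ones was settled by
the preceding `visit`. -/
theorem loop_sound (hm0 : 0 < m) (hN : S.conductor + m < 255) (hg : S.genus ≤ 50)
    (hm : ∀ s ∈ S.elements, s ≠ 0 → m ≤ s) {fuel y : ℕ} (hy : 0 < y)
    (hf : y + fuel + 1 = S.conductor) (hne : S.lowGens y ≠ S.lowGens S.conductor)
    (h : loop S.conductor m (S.conductor + m) fuel
      (digits (ind (S.lowSpan y)) (S.conductor + m))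
      (digits (ind (apery m (S.lowSpan y))) (S.conductor + m))
      (count (ind (S.lowSpan y)) S.conductor) (S.lowGens y).card y = true) :
    S.conductor ≤ S.embeddingDim * count (ind S.elements) S.conductor := by
  induction fuel generalizing y with
  | zero =>
    -- Now `y = c - 1`, a gap, so no left generator is left to find.
    refine absurd ?_ hne
    rw [← hf]
    refine (lowGens_succ_of_not_mem fun hmem => ?_).symm
    refine conductor_sub_one_not_mem (S := S) (by omega) ?_
    rw [← hf]
    exact hmem.1
  | succ fuel ih =>
    have e (c N X A L p : ℕ) : loop c m N (fuel + 1) X A L p y = eager (y + 1) fun y' =>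
      select (mem N X y) (loop c m N fuel X A L p y')
        (select (eager (N / y) fun K => prune c m p L K y c 1 (A % 255) A) true
          (select (eager (extend y X (N / y)) fun T => eager (p + 1) fun p' =>
              visit c m N T p' fun L' => loop c m N fuel T (aperyCode m T) L' p' y')
            (loop c m N fuel X A L p y') false)) := rfl
    have hskip (hg' : y ∉ S.minimalGenerators) (h' : loop S.conductor m (S.conductor + m) fuel
        (digits (ind (S.lowSpan y)) (S.conductor + m))
        (digits (ind (apery m (S.lowSpan y))) (S.conductor + m))
        (count (ind (S.lowSpan y)) S.conductor) (S.lowGens y).card (y + 1) = true) :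
        S.conductor ≤ S.embeddingDim * count (ind S.elements) S.conductor := by
      have h1 := lowGens_succ_of_not_mem hg'
      have h2 : S.lowSpan (y + 1) = S.lowSpan y := by rw [lowSpan, h1, lowSpan]
      exact ih (y := y + 1) (by omega) (by omega) (by rwa [h1]) (by rwa [h1, h2])
    rw [e, eager_eq, select_eq] at h
    split_ifs at h with h1
    · rw [mem_eq_true_iff (by omega)] at h1
      exact hskip (not_mem_minimalGenerators_of_mem_lowSpan h1 le_rfl) h
    · rw [select_eq, eager_eq, digits_ind_mod hN] at h
      split_ifs at h with h2
      · exact prune_lowSpan_sound hm0 hg hm hy (by omega) hne h2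
      · rw [select_eq] at h
        split_ifs at h with h3
        by_cases hgen : y ∈ S.minimalGenerators
        · have h4 := lowGens_succ_of_mem hgen
          have h5 : (S.lowGens (y + 1)).card = (S.lowGens y).card + 1 := by
            rw [h4, Finset.card_insert_of_notMem fun hc => absurd (mem_lowGens.1 hc).1 (by omega)]
          have h6 : extend y (digits (ind (S.lowSpan y)) (S.conductor + m))
              ((S.conductor + m) / y) = digits (ind (S.lowSpan (y + 1))) (S.conductor + m) := by
            rw [extend_eq]
            refine digits_congr fun i hi => ?_
            have hmem : i ∈ S.lowSpan (y + 1) ↔ ∃ j, ∃ u ∈ S.lowSpan y, i = u + j * y := by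
              rw [lowSpan, h4, Finset.coe_insert]
              exact mem_closure_insert_iff
            by_cases hi' : i ∈ S.lowSpan (y + 1)
            · rw [ind_of_mem (U := (S.lowSpan (y + 1) : Set ℕ)) hi']
              obtain ⟨j, u, hu, rfl⟩ := hmem.1 hi'
              refine ind_of_mem ⟨j, ?_, u, hu, rfl⟩
              -- Since `u + j * y < c + m`, at most `(c + m) / y` multiples are needed.
              rw [Nat.le_div_iff_mul_le hy]
              omega
            · rw [ind_of_not_mem (U := (S.lowSpan (y + 1) : Set ℕ)) hi']
              refine ind_of_not_mem ?_
              rintro ⟨j, -, u, hu, rfl⟩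
              exact hi' (hmem.2 ⟨j, u, hu, rfl⟩)
          rw [eager_eq, eager_eq, h6, ← h5] at h3
          obtain ⟨h7, h8⟩ := visit_sound (by omega) hN hg hm h3
          rw [aperyCode_eq] at h8
          by_cases h9 : S.lowGens (y + 1) = S.lowGens S.conductor
          · exact h7 h9
          · exact ih (by omega) (by omega) h9 h8
        · exact hskip hgen h

theorem search_sound (hm0 : 0 < m) (hmc : m + 2 ≤ S.conductor) (hN : S.conductor + m < 255)
    (hg : S.genus ≤ 50) (hmS : m ∈ S.elements) (hm : ∀ s ∈ S.elements, s ≠ 0 → m ≤ s)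
    (h : search S.conductor m = true) :
    S.conductor ≤ S.embeddingDim * count (ind S.elements) S.conductor := by
  have h1 : S.lowGens (m + 1) = {m} := by
    ext a
    rw [mem_lowGens, Finset.mem_singleton]
    constructor
    · rintro ⟨ha, hga⟩
      have := hm a hga.1 hga.2.1
      omega
    · rintro rfl
      refine ⟨by omega, hmS, by omega, fun x hx y hy hx0 hy0 hxy => ?_⟩
      have := hm x hx hx0
      omega
  have hspan : ∀ i, i ∈ S.lowSpan (m + 1) ↔ ∃ j, j * m = i := fun i => by
    rw [lowSpan, h1, Finset.coe_singleton, AddSubmonoid.mem_closure_singleton]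
    rfl
  -- The element 0 occupies the most significant of the `c + m` digits.
  have h0 : digits (ind {0}) (S.conductor + m) = 256 ^ (S.conductor + m - 1) := by
    obtain ⟨n, hn⟩ : ∃ n, S.conductor + m = n + 1 := ⟨S.conductor + m - 1, by omega⟩
    rw [hn, Nat.add_sub_cancel]
    clear hn
    induction n with
    | zero => simp [digits, ind]
    | succ n ih => rw [digits, ih, ind_of_not_mem (by simp)]; ring
  have h2 : extend m (256 ^ (S.conductor + m - 1)) ((S.conductor + m) / m)
      = digits (ind (S.lowSpan (m + 1))) (S.conductor + m) := by
    rw [← h0, extend_eq]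
    refine digits_congr fun i hi => ?_
    by_cases hi' : i ∈ S.lowSpan (m + 1)
    · rw [ind_of_mem (U := (S.lowSpan (m + 1) : Set ℕ)) hi']
      obtain ⟨j, rfl⟩ := (hspan i).1 hi'
      refine ind_of_mem ⟨j, ?_, 0, rfl, by omega⟩
      rw [Nat.le_div_iff_mul_le hm0]
      omega
    · rw [ind_of_not_mem (U := (S.lowSpan (m + 1) : Set ℕ)) hi']
      refine ind_of_not_mem ?_
      rintro ⟨j, -, u, rfl, rfl⟩
      exact hi' ((hspan _).2 ⟨j, by omega⟩)
  have e (c : ℕ) : search c m = eager (c + m) fun N =>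
    eager (extend m (256 ^ (N - 1)) (N / m)) fun T => visit c m N T (S.lowGens (m + 1)).card
      fun L => loop c m N (c - (m + 2)) T (aperyCode m T) L (S.lowGens (m + 1)).card (m + 1) := by
    rw [h1, Finset.card_singleton]
    rfl
  rw [e, eager_eq, eager_eq, h2] at h
  obtain ⟨h4, h5⟩ := visit_sound (by omega) hN hg hm h
  rw [aperyCode_eq] at h5
  by_cases h6 : S.lowGens (m + 1) = S.lowGens S.conductor
  · exact h4 h6
  · exact loop_sound hm0 hN hg hm (by omega) (by omega) h6 h5

end Soundness
end WilfSearch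

/-! ### Evaluation for conductors 3 to 100 -/

namespace WilfSearch

theorem searchRange_3 : searchRange 3 42 = true := by decide +kernel

theorem searchRange_45 : searchRange 45 7 = true := by decide +kernel

theorem searchRange_52 : searchRange 52 4 = true := by decide +kernel

theorem searchRange_56 : searchRange 56 3 = true := by decide +kernel

theorem searchRange_59 : searchRange 59 2 = true := by decide +kernel

theorem searchRange_61 : searchRange 61 2 = true := by decide +kernel

theorem searchRange_63 : searchRange 63 4 = true := by decide +kernel

theorem searchRange_67 : searchRange 67 8 = true := by decide +kernel

theorem searchRange_75 : searchRange 75 26 = true := by decide +kernel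

theorem search_eq_true {c m : ℕ} (hc : c ≤ 100) (h2 : 2 ≤ m) (hm : m + 2 ≤ c) :
    search c m = true := by
  rcases Nat.lt_or_ge c 45 with h | h
  · exact searchRange_sound searchRange_3 (by omega) h h2 hm
  rcases Nat.lt_or_ge c 52 with h | h
  · exact searchRange_sound searchRange_45 (by omega) h h2 hm
  rcases Nat.lt_or_ge c 56 with h | h
  · exact searchRange_sound searchRange_52 (by omega) h h2 hm
  rcases Nat.lt_or_ge c 59 with h | h
  · exact searchRange_sound searchRange_56 (by omega) h h2 hm
  rcases Nat.lt_or_ge c 61 with h | h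
  · exact searchRange_sound searchRange_59 (by omega) h h2 hm
  rcases Nat.lt_or_ge c 63 with h | h
  · exact searchRange_sound searchRange_61 (by omega) h h2 hm
  rcases Nat.lt_or_ge c 67 with h | h
  · exact searchRange_sound searchRange_63 (by omega) h h2 hm
  rcases Nat.lt_or_ge c 75 with h | h
  · exact searchRange_sound searchRange_67 (by omega) h h2 hm
  · exact searchRange_sound searchRange_75 (by omega) (by omega) h2 hm

end WilfSearch

/-! ### Reduction to the search and conclusion -/

namespace NumericalSemigroup

open WilfSearch

theorem exists_multiplicity (S : NumericalSemigroup) :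
    ∃ m ∈ S.elements, 0 < m ∧ ∀ s ∈ S.elements, s ≠ 0 → m ≤ s := by
  classical
  have h : ∃ m, m ∈ S.elements ∧ m ≠ 0 :=
    ⟨S.conductor + 1, S.mem_of_conductor_le (by omega), by omega⟩
  exact ⟨Nat.find h, (Nat.find_spec h).1, Nat.pos_of_ne_zero (Nat.find_spec h).2,
    fun s hs hs0 => Nat.find_min' h ⟨hs, hs0⟩⟩

theorem count_elements_pos {S : NumericalSemigroup} (h : 0 < S.conductor) :
    0 < count (ind S.elements) S.conductor := by
  have := le_count (ind S.elements) h
  rwa [ind_of_mem (U := S.elements) (zero_mem S.toAddSubmonoid)] at this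

/-- A numerical semigroup whose conductor does not exceed its multiplicity has at least as many
minimal generators as its multiplicity. -/
theorem multiplicity_le_embeddingDim {S : NumericalSemigroup} {m : ℕ}
    (hm : ∀ s ∈ S.elements, s ≠ 0 → m ≤ s) (hc : 0 < S.conductor) (hcm : S.conductor ≤ m) :
    m ≤ S.embeddingDim := by
  have h1 : S.lowGens S.conductor = ∅ := by
    refine Finset.eq_empty_of_forall_notMem fun a ha => ?_
    rw [mem_lowGens] at ha
    have := hm a ha.2.1 ha.2.2.1
    omega
  have h2 (i : ℕ) (hi : i ≠ 0) : i ∉ S.lowSpan S.conductor := by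
    rw [lowSpan, h1, Finset.coe_empty, AddSubmonoid.closure_empty, AddSubmonoid.mem_bot]
    exact hi
  have h3 : count (ind (S.lowSpan S.conductor)) (S.conductor + m)
      = count (ind (S.lowSpan S.conductor)) S.conductor := by
    classical
    rw [count_ind_add, Finset.filter_false_of_mem, Finset.card_empty, add_zero]
    intro i hi
    have := (Finset.mem_Ico.1 hi).1
    exact h2 i (by omega)
  have h4 := card_lowGens_add_le_embeddingDim S hm
  omega

/-- Wilf's inequality, for genus at most `50`. -/
theorem conductor_le_embeddingDim_mul {S : NumericalSemigroup} (hg : S.genus ≤ 50) :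
    S.conductor ≤ S.embeddingDim * count (ind S.elements) S.conductor := by
  obtain ⟨m, hmS, hm0, hm⟩ := S.exists_multiplicity
  rcases Nat.eq_zero_or_pos S.conductor with h0 | hc
  · rw [h0]
    exact Nat.zero_le _
  have h1 := count_elements_add_genus S
  have h2 := count_elements_le_genus S
  have h3 := conductor_sub_one_not_mem hc
  rcases Nat.lt_or_ge m S.conductor with hcm | hcm
  -- The search needs `2 ≤ m ≤ c - 2`: `c - 1` is a gap, and `m = 1` would make it an element.
  · have h4 : m ≠ S.conductor - 1 := by
      rintro rfl
      exact h3 hmS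
    have h5 : m ≠ 1 := by
      rintro rfl
      refine h3 ?_
      have := nsmul_mem (S := S.toAddSubmonoid) hmS (S.conductor - 1)
      rwa [smul_eq_mul, mul_one] at this
    exact search_sound hm0 (by omega) (by omega) hg hmS hm
      (search_eq_true (by omega) (by omega) (by omega))
  · calc S.conductor ≤ S.embeddingDim := hcm.trans (multiplicity_le_embeddingDim hm hc hcm)
      _ ≤ _ := Nat.le_mul_of_pos_right _ (count_elements_pos hc)

end NumericalSemigroup

theorem mainTheorem2 (S : NumericalSemigroup) (hS : S.genus ≤ 50) :
    (S.conductor : ℤ) ≤ (S.embeddingDim : ℤ) * ((S.conductor : ℤ) - (S.genus : ℤ)) ∧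
    (1 ≤ S.genus → S.genus < S.conductor ∧
      (S.conductor : ℚ) / ((S.conductor : ℚ) - (S.genus : ℚ)) ≤ (S.embeddingDim : ℚ)) := by
  have h1 := S.count_elements_add_genus
  have h2 := NumericalSemigroup.conductor_le_embeddingDim_mul hS
  set L := WilfSearch.count (WilfSearch.ind S.elements) S.conductor with hL
  refine ⟨?_, fun hg => ?_⟩
  · have h3 : (S.conductor : ℤ) - S.genus = L := by omega
    rw [h3]
    exact_mod_cast h2
  · have hpos : 0 < L := NumericalSemigroup.count_elements_pos (by omega)
    have h3 : (S.conductor : ℚ) - S.genus = L := by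
      rw [← h1]
      push_cast
      ring
    refine ⟨by omega, ?_⟩
    rw [h3, div_le_iff₀ (by exact_mod_cast hpos)]
    exact_mod_cast h2
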